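/- For $k\ge 1$ let $X_k$ be a random symmetric $2\times 2$ integer matrix whose entries on and above the diagonal are independent and uniformly distributed on $\{1,\dots,k\}$. The level of a rational matrix $Q$ is the least integer $\ell\ge 1$ such that $\ell Q$ has integer entries; let $\mathbb{O}_2(\ell,\mathbb{Q})$ denote the set of rational orthogonal $2\times 2$ matrices of level $\ell$. Then for every $L$ the limit over $k$ below exists, the limit over $L$ exists as well, and $$\lim_{L\to\infty}\lim_{k\to\infty}\mathbb{P}\Bigl(\exists\, Q\in\bigcup_{\ell=2}^{L}\mathbb{O}_2(\ell,\mathbb{Q}) : Q^{\mathsf T}X_kQ\in\mathbb{Z}^{2\times 2}\Bigr)\le\frac{12\,G}{\pi^2}-1,$$ where $G=\sum_{m=0}^{\infty}\frac{(-1)^m}{(2m+1)^2}$ is Catalan's constant. Numerically, $12G/\pi^2-1\approx 0.1137$, correct to four decimal places. -/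

import Mathlib

open MeasureTheory ProbabilityTheory Filter Topology

/-- A rational matrix has integer entries. -/
def HasIntegerEntries {n : ℕ} (A : Matrix (Fin n) (Fin n) ℚ) : Prop :=
  ∃ B : Matrix (Fin n) (Fin n) ℤ, A = B.map (Int.cast : ℤ → ℚ)

/-- The level of a rational matrix `Q`: the least integer `ℓ ≥ 1` such that `ℓ Q` has integer
entries. -/
noncomputable def matrixLevel {n : ℕ} (Q : Matrix (Fin n) (Fin n) ℚ) : ℕ :=
  sInf {l : ℕ | 1 ≤ l ∧ HasIntegerEntries ((l : ℚ) • Q)}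

/-- The set of rational orthogonal `n × n` matrices of level `l`. -/
def rationalOrthogonal (n l : ℕ) : Set (Matrix (Fin n) (Fin n) ℚ) :=
  {Q | Q ∈ Matrix.orthogonalGroup (Fin n) ℚ ∧ matrixLevel Q = l}

/-- The integer matrix `A` is such that `Qᵀ A Q` is again an integer matrix for some rational
orthogonal matrix `Q` whose level lies in `[2, L]`. -/
def RationallyCospectral {n : ℕ} (L : ℕ) (A : Matrix (Fin n) (Fin n) ℤ) : Prop :=
  ∃ Q ∈ ⋃ l ∈ Set.Icc 2 L, rationalOrthogonal n l,
    HasIntegerEntries (Q.transpose * A.map (Int.cast : ℤ → ℚ) * Q)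

/-- `X` is a random symmetric integer `n × n` matrix whose entries on and above the diagonal are
independent and uniformly distributed on `{1, …, k}`. -/
structure IsUniformSymmetric {Ω : Type*} [MeasurableSpace Ω] (μ : Measure Ω) {n : ℕ}
    (X : Ω → Matrix (Fin n) (Fin n) ℤ) (k : ℕ) : Prop where
  measurable_entry : ∀ i j, Measurable fun ω => X ω i j
  isSymm : ∀ ω, (X ω).IsSymm
  indep : iIndepFun (fun (p : {p : Fin n × Fin n // p.1 ≤ p.2}) ω => X ω p.1.1 p.1.2) μ
  uniform : ∀ i j, i ≤ j → μ.map (fun ω => X ω i j) = uniformOn (Set.Icc (1 : ℤ) (k : ℤ))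

/-- Catalan's constant. -/
noncomputable def catalanConstant : ℝ := ∑' m : ℕ, (-1 : ℝ) ^ m / (2 * (m : ℝ) + 1) ^ 2

/-! Let `Q` have level `l ≥ 2`, let `p` be a prime factor of `l`, and let `(x, y)` be the first
column of `l Q`. Then `x² + y² = l²`, and minimality of the level makes `x` a unit mod `p`. Hence `r
= y / x` satisfies `r² = -1` mod `p²`, which forces `p ≡ 1` mod 4. For `A = (a b; b c)`, integrality
of the top left entry of `QᵀAQ` gives `a - c + 2 r b = 0` mod `p²`
(`RationallyCospectral.exists_root`).

There are at most two such `r`, and each linear congruence has limiting probability at most `1 /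
p²`. The union bound therefore gives at most `∑ 2 / p²` over primes `p ≡ 1` mod 4, uniformly in `L`.
This sum is compared with the constant only numerically: `0.1136` against `0.1137`.

The limit in `k` exists because the event depends only on residues mod `L!²`, which equidistribute;
the limit in `L` exists by monotonicity and boundedness. -/

/-! ### Numerical estimates -/

theorem abs_catalan_approx : |12 * catalanConstant / Real.pi ^ 2 - 1 - 0.1137| < 0.00005 := by
  set f : ℕ → ℝ := fun m => 1 / (2 * (m : ℝ) + 1) ^ 2 with hf
  have hanti : Antitone f := by
    intro a b hab
    have : (a : ℝ) ≤ b := by exact_mod_cast hab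
    simp only [hf]
    gcongr
  have hsumm : Summable fun m : ℕ => (-1 : ℝ) ^ m * f m := by
    apply Summable.of_norm
    have h1 : Summable fun m : ℕ => 1 / ((m + 1 : ℕ) : ℝ) ^ 2 :=
      (summable_nat_add_iff 1).2 (Real.summable_one_div_nat_pow.2 (by norm_num))
    refine Summable.of_nonneg_of_le (fun _ => norm_nonneg _) (fun m => ?_) h1
    simp only [norm_mul, norm_pow, norm_neg, norm_one, one_pow, one_mul, hf, Real.norm_eq_abs]
    rw [abs_of_nonneg (by positivity)]
    push_cast
    gcongr
    linarith [(Nat.cast_nonneg m : (0 : ℝ) ≤ m)]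
  have hG : catalanConstant = ∑' m : ℕ, (-1 : ℝ) ^ m * f m := by
    simp only [catalanConstant, hf, mul_one_div]
  have htend := hsumm.hasSum.tendsto_sum_nat
  rw [← hG] at htend
  have hlo := hanti.alternating_series_le_tendsto htend 60
  have hhi := hanti.tendsto_le_alternating_series htend 60
  -- These two partial sums bracket the constant and differ by `1 / 241² < 2 · 10⁻⁵`, which is
  -- enough for four decimals.
  have e1 : (0.91595 : ℝ) ≤ ∑ i ∈ Finset.range (2 * 60), (-1 : ℝ) ^ i * f i := by
    norm_num [Finset.sum_range_succ, hf]
  have e2 : ∑ i ∈ Finset.range (2 * 60 + 1), (-1 : ℝ) ^ i * f i ≤ 0.91598 := by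
    norm_num [Finset.sum_range_succ, hf]
  replace hlo := e1.trans hlo
  replace hhi := hhi.trans e2
  clear e1 e2 htend hG
  have hpi1 := Real.pi_gt_d6
  have hpi2 := Real.pi_lt_d6
  have hp1 : (9.8696 : ℝ) < Real.pi ^ 2 := by nlinarith
  have hp2 : Real.pi ^ 2 < 9.86961 := by nlinarith
  have hpos : (0 : ℝ) < Real.pi ^ 2 := by positivity
  have h1 : 1.11365 < 12 * catalanConstant / Real.pi ^ 2 := by
    rw [lt_div_iff₀ hpos]
    linarith
  have h2 : 12 * catalanConstant / Real.pi ^ 2 < 1.11375 := by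
    rw [div_lt_iff₀ hpos]
    linarith
  rw [abs_lt]
  constructor <;> linarith

/-- The terms with `4 j + 1 ≤ 61` are summed exactly. In the tail primality is dropped and the
series over all `4 n + 65` is telescoped. -/
theorem sum_prime_le (m : ℕ) :
    ∑ j ∈ Finset.range m, (if (4 * j + 1).Prime then 2 / ((4 * j + 1 : ℕ) : ℝ) ^ 2 else 0)
      ≤ 0.1136 := by
  set g : ℕ → ℝ := fun j => if (4 * j + 1).Prime then 2 / ((4 * j + 1 : ℕ) : ℝ) ^ 2 else 0 with hg
  have hg0 : ∀ j, 0 ≤ g j := fun j => by simp only [hg]; split_ifs <;> positivity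
  have key : ∀ n, ∑ j ∈ Finset.range (16 + n), g j ≤ 0.1136 - 1 / (2 * (4 * (n : ℝ) + 63)) := by
    intro n
    induction n with
    | zero => norm_num [hg, Finset.sum_range_succ]
    | succ n ih =>
      rw [← add_assoc, Finset.sum_range_succ]
      have : g (16 + n) ≤ 2 / (4 * (n : ℝ) + 65) ^ 2 := by
        simp only [hg]
        split_ifs
        · apply le_of_eq
          push_cast
          ring
        · positivity
      -- The right side equals `2 / ((4n + 65)² - 4)`.
      have h2 : 2 / (4 * (n : ℝ) + 65) ^ 2 ≤
          1 / (2 * (4 * (n : ℝ) + 63)) - 1 / (2 * (4 * ((n + 1 : ℕ) : ℝ) + 63)) := by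
        push_cast
        rw [div_sub_div _ _ (by positivity) (by positivity),
          div_le_div_iff₀ (by positivity) (by positivity)]
        nlinarith [(Nat.cast_nonneg n : (0 : ℝ) ≤ n)]
      linarith
  calc ∑ j ∈ Finset.range m, g j ≤ ∑ j ∈ Finset.range (16 + m), g j :=
        Finset.sum_le_sum_of_subset_of_nonneg (Finset.range_mono (by omega)) fun _ _ _ => hg0 _
    _ ≤ 0.1136 := (key m).trans (by
        have : 0 ≤ 1 / (2 * (4 * (m : ℝ) + 63)) := by positivity
        linarith)

/-! ### Square roots of `-1` modulo `p²` -/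

/-- `p²` divides `(x - y)(x + y)`, and `p` cannot divide both factors, since it would divide `2x`
while `x² ≡ -1`. So all of `p²` divides one factor. -/
theorem ZMod.eq_or_eq_neg_of_sq_eq_neg_one {p : ℕ} (hp : p.Prime) (hp2 : p ≠ 2)
    {r s : ZMod (p ^ 2)} (hr : r ^ 2 = -1) (hs : s ^ 2 = -1) : r = s ∨ r = -s := by
  obtain ⟨x, rfl⟩ := ZMod.intCast_surjective r
  obtain ⟨y, rfl⟩ := ZMod.intCast_surjective s
  have hpZ : Prime (p : ℤ) := Nat.prime_iff_prime_int.1 hp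
  have hmul : ((p : ℤ) ^ 2) ∣ (x - y) * (x + y) := by
    have : (((x - y) * (x + y) : ℤ) : ZMod (p ^ 2)) = 0 := by
      push_cast
      linear_combination hr - hs
    exact_mod_cast (ZMod.intCast_zmod_eq_zero_iff_dvd _ _).1 this
  have hx : ((p : ℤ) ^ 2) ∣ x ^ 2 + 1 := by
    have : ((x ^ 2 + 1 : ℤ) : ZMod (p ^ 2)) = 0 := by
      push_cast
      linear_combination hr
    exact_mod_cast (ZMod.intCast_zmod_eq_zero_iff_dvd _ _).1 this
  have hnot : ¬ ((p : ℤ) ∣ x - y ∧ (p : ℤ) ∣ x + y) := by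
    rintro ⟨h1, h2⟩
    have h3 : (p : ℤ) ∣ 2 * x := by
      have := dvd_add h1 h2
      ring_nf at this ⊢
      exact this
    rcases hpZ.dvd_or_dvd h3 with h | h
    · exact hp2 ((Nat.prime_dvd_prime_iff_eq hp Nat.prime_two).1 (by exact_mod_cast h))
    · have h4 : (p : ℤ) ∣ 1 := by
        have := (dvd_pow_self (p : ℤ) two_ne_zero).trans hx
        exact (Int.dvd_add_right (dvd_pow h two_ne_zero)).1 this
      exact hpZ.not_isUnit (isUnit_of_dvd_one h4)
  rw [← sub_eq_zero, ← sub_eq_zero (b := -(y : ZMod (p ^ 2)))]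
  rcases not_and_or.1 hnot with h | h
  · right
    have : ((p : ℤ) ^ 2) ∣ x + y :=
      (((Prime.coprime_iff_not_dvd hpZ).2 h).pow_left).dvd_of_dvd_mul_left hmul
    have h5 := (ZMod.intCast_zmod_eq_zero_iff_dvd (x + y) (p ^ 2)).2 (by exact_mod_cast this)
    push_cast at h5
    linear_combination h5
  · left
    have : ((p : ℤ) ^ 2) ∣ x - y :=
      (((Prime.coprime_iff_not_dvd hpZ).2 h).pow_left).dvd_of_dvd_mul_right hmul
    have h5 := (ZMod.intCast_zmod_eq_zero_iff_dvd (x - y) (p ^ 2)).2 (by exact_mod_cast this)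
    push_cast at h5
    linear_combination h5

/-- There are at most two square roots of `-1` modulo the square of an odd prime. -/
theorem ZMod.ncard_sq_eq_neg_one_le {p : ℕ} (hp : p.Prime) (hp2 : p ≠ 2) :
    {r : ZMod (p ^ 2) | r ^ 2 = -1}.ncard ≤ 2 := by
  rcases Set.eq_empty_or_nonempty {r : ZMod (p ^ 2) | r ^ 2 = -1} with h | ⟨s, hs⟩
  · simp [h]
  · exact (Set.ncard_le_ncard (t := {s, -s})
      (fun r hr => ZMod.eq_or_eq_neg_of_sq_eq_neg_one hp hp2 hr hs)).trans (by
        simpa using Set.ncard_insert_le s {-s})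

/-- The modulus `p²` matters at `p = 2`: `-1` is a square mod 2 but not mod 4. -/
theorem prime_mod_four_eq_one_of_sq_eq_neg_one {p : ℕ} (hp : p.Prime) {r : ZMod (p ^ 2)}
    (hr : r ^ 2 = -1) : p % 4 = 1 := by
  have : Fact p.Prime := ⟨hp⟩
  have h3 : p % 4 ≠ 3 := by
    refine ZMod.mod_four_ne_three_of_sq_eq_neg_one (p := p)
      (y := ZMod.castHom (dvd_pow_self p two_ne_zero) (ZMod p) r) ?_
    rw [← map_pow, hr, map_neg, map_one]
  have h2 : p ≠ 2 := by
    rintro rfl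
    revert hr
    change ZMod 4 at r
    change (r : ZMod 4) ^ 2 = -1 → False
    revert r
    decide
  have := hp.eq_two_or_odd
  omega

/-! ### From a rational orthogonal matrix to a congruence -/

/-- If `p ∣ l` divided the corner entry, the norms of the first row and of both columns would make
it divide every entry, and `(l / p) Q` would already be integral. -/
theorem exists_integer_model_of_level {Q : Matrix (Fin 2) (Fin 2) ℚ} {l : ℕ} (hl : 2 ≤ l)
    (hQ : Q ∈ rationalOrthogonal 2 l) :
    ∃ B : Matrix (Fin 2) (Fin 2) ℤ, (l : ℚ) • Q = B.map (Int.cast : ℤ → ℚ) ∧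
      B 0 0 ^ 2 + B 1 0 ^ 2 = (l : ℤ) ^ 2 ∧
      ∀ p : ℕ, p.Prime → p ∣ l → ¬ ((p : ℤ) ∣ B 0 0) := by
  obtain ⟨hO, hlev⟩ := hQ
  -- `sInf ∅ = 0`, so a positive level shows that some multiple of `Q` is integral.
  have hmem := Nat.sInf_mem (Nat.nonempty_of_pos_sInf (s := {l : ℕ | 1 ≤ l ∧
    HasIntegerEntries ((l : ℚ) • Q)}) (by change 0 < matrixLevel Q; omega))
  change matrixLevel Q ∈ _ at hmem
  rw [hlev] at hmem
  obtain ⟨-, B, hB⟩ := hmem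
  have hlQ : (l : ℚ) ≠ 0 := by positivity
  have hE : ∀ i j, (l : ℚ) * Q i j = B i j := fun i j => by
    have := congrFun (congrFun hB i) j
    simpa using this
  have hQQ := (Matrix.mem_orthogonalGroup_iff (Fin 2) ℚ).1 hO
  have hQQ' := (Matrix.mem_orthogonalGroup_iff' (Fin 2) ℚ).1 hO
  have c00 := congrFun (congrFun hQQ' 0) 0
  have c11 := congrFun (congrFun hQQ' 1) 1
  have r00 := congrFun (congrFun hQQ 0) 0
  simp [Matrix.mul_apply, Fin.sum_univ_two] at c00 c11 r00
  have e1 : B 0 0 ^ 2 + B 1 0 ^ 2 = (l : ℤ) ^ 2 := by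
    have : (B 0 0 : ℚ) ^ 2 + (B 1 0 : ℚ) ^ 2 = (l : ℚ) ^ 2 := by
      rw [← hE, ← hE]; linear_combination (l : ℚ) ^ 2 * c00
    exact_mod_cast this
  have e2 : B 0 1 ^ 2 + B 1 1 ^ 2 = (l : ℤ) ^ 2 := by
    have : (B 0 1 : ℚ) ^ 2 + (B 1 1 : ℚ) ^ 2 = (l : ℚ) ^ 2 := by
      rw [← hE, ← hE]; linear_combination (l : ℚ) ^ 2 * c11
    exact_mod_cast this
  have e3 : B 0 0 ^ 2 + B 0 1 ^ 2 = (l : ℤ) ^ 2 := by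
    have : (B 0 0 : ℚ) ^ 2 + (B 0 1 : ℚ) ^ 2 = (l : ℚ) ^ 2 := by
      rw [← hE, ← hE]; linear_combination (l : ℚ) ^ 2 * r00
    exact_mod_cast this
  refine ⟨B, hB, e1, fun p hp hpl h00 => ?_⟩
  have hpZ : Prime (p : ℤ) := Nat.prime_iff_prime_int.1 hp
  have hplZ : (p : ℤ) ∣ (l : ℤ) ^ 2 := dvd_pow (by exact_mod_cast hpl) two_ne_zero
  have h10 : (p : ℤ) ∣ B 1 0 := hpZ.dvd_of_dvd_pow
    ((Int.dvd_add_right (dvd_pow h00 two_ne_zero)).1 (e1 ▸ hplZ))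
  have h01 : (p : ℤ) ∣ B 0 1 := hpZ.dvd_of_dvd_pow
    ((Int.dvd_add_right (dvd_pow h00 two_ne_zero)).1 (e3 ▸ hplZ))
  have h11 : (p : ℤ) ∣ B 1 1 := hpZ.dvd_of_dvd_pow
    ((Int.dvd_add_right (dvd_pow h01 two_ne_zero)).1 (e2 ▸ hplZ))
  have hall : ∀ i j, (p : ℤ) ∣ B i j := by
    intro i j
    fin_cases i <;> fin_cases j <;> assumption
  choose C hC using hall
  obtain ⟨m, rfl⟩ := hpl
  have hm0 : 0 < m := by
    rcases Nat.eq_zero_or_pos m with h | h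
    · subst h; omega
    · exact h
  have hlt : m < matrixLevel Q := by
    rw [hlev]
    nlinarith [hp.two_le]
  refine Nat.notMem_of_lt_sInf hlt ⟨hm0, Matrix.of C, ?_⟩
  ext i j
  have h1 := hE i j
  rw [hC] at h1
  push_cast at h1
  have hp0 : (p : ℚ) ≠ 0 := by exact_mod_cast hp.ne_zero
  simp only [Matrix.smul_apply, smul_eq_mul, Matrix.map_apply, Matrix.of_apply]
  apply mul_left_cancel₀ hp0
  linear_combination h1

theorem RationallyCospectral.exists_root {L : ℕ} {A : Matrix (Fin 2) (Fin 2) ℤ}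
    (hA : A.IsSymm) (h : RationallyCospectral L A) :
    ∃ j < L, (4 * j + 1).Prime ∧ ∃ r : ZMod ((4 * j + 1) ^ 2), r ^ 2 = -1 ∧
      (A 0 0 : ZMod ((4 * j + 1) ^ 2)) - (A 1 1 : ZMod ((4 * j + 1) ^ 2)) +
        2 * r * (A 0 1 : ZMod ((4 * j + 1) ^ 2)) = 0 := by
  obtain ⟨Q, hQ, N, hN⟩ := h
  simp only [Set.mem_iUnion] at hQ
  obtain ⟨l, ⟨hl2, hlL⟩, hQl⟩ := hQ
  obtain ⟨B, hB, hsq, hprim⟩ := exists_integer_model_of_level hl2 hQl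
  have hE : ∀ i j, (l : ℚ) * Q i j = B i j := fun i j => by
    have := congrFun (congrFun hB i) j
    simpa using this
  have hp : l.minFac.Prime := Nat.minFac_prime (by omega)
  have hpl := Nat.minFac_dvd l
  have hple : l.minFac ≤ l := Nat.minFac_le (by omega)
  have hx := hprim _ hp hpl
  set p := l.minFac
  have hform : B 0 0 ^ 2 * A 0 0 + 2 * B 0 0 * B 1 0 * A 0 1 + B 1 0 ^ 2 * A 1 1
      = (l : ℤ) ^ 2 * N 0 0 := by
    have h00 := congrFun (congrFun hN 0) 0
    have hs : A 1 0 = A 0 1 := hA.apply 0 1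
    simp [Matrix.mul_apply, Fin.sum_univ_two, hs] at h00
    have : (B 0 0 : ℚ) ^ 2 * A 0 0 + 2 * B 0 0 * B 1 0 * A 0 1 + (B 1 0 : ℚ) ^ 2 * A 1 1
      = (l : ℚ) ^ 2 * N 0 0 := by
      rw [← hE, ← hE, ← h00]; ring
    exact_mod_cast this
  have hl0 : ((l : ℤ) : ZMod (p ^ 2)) ^ 2 = 0 := by
    have : ((l ^ 2 : ℕ) : ZMod (p ^ 2)) = 0 :=
      (ZMod.natCast_eq_zero_iff _ _).2 (pow_dvd_pow_of_dvd hpl 2)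
    exact_mod_cast this
  have hux : IsUnit ((B 0 0 : ℤ) : ZMod (p ^ 2)) := by
    have hco : IsCoprime ((p : ℤ) ^ 2) (B 0 0) :=
      ((Prime.coprime_iff_not_dvd (Nat.prime_iff_prime_int.1 hp)).2 hx).pow_left
    obtain ⟨u, v, huv⟩ := hco
    have := congrArg (Int.cast : ℤ → ZMod (p ^ 2)) huv
    push_cast at this
    have hp0 : (p : ZMod (p ^ 2)) ^ 2 = 0 := by exact_mod_cast ZMod.natCast_self (p ^ 2)
    rw [hp0, mul_zero, zero_add] at this
    exact IsUnit.of_mul_eq_one_right _ this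
  obtain ⟨u, hu⟩ := hux
  -- Modulo `p²` both right sides vanish. Dividing by the square of the unit `u` gives `r² = -1` and
  -- the linear relation, with `r = y / u`.
  have h1 := congrArg (Int.cast : ℤ → ZMod (p ^ 2)) hsq
  have h2 := congrArg (Int.cast : ℤ → ZMod (p ^ 2)) hform
  push_cast at h1 h2 hl0
  rw [hl0, ← hu] at h1
  rw [hl0, ← hu] at h2
  set y : ZMod (p ^ 2) := ((B 1 0 : ℤ) : ZMod (p ^ 2))
  have huu : (u : ZMod (p ^ 2)) * ((u⁻¹ : (ZMod (p ^ 2))ˣ) : ZMod (p ^ 2)) = 1 := u.mul_inv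
  set v : ZMod (p ^ 2) := ((u⁻¹ : (ZMod (p ^ 2))ˣ) : ZMod (p ^ 2))
  have hr : (y * v) ^ 2 = -1 := by
    linear_combination v ^ 2 * h1 - ((u : ZMod (p ^ 2)) * v + 1) * huu
  have hlin : (A 0 0 : ZMod (p ^ 2)) - (A 1 1 : ZMod (p ^ 2)) + 2 * (y * v) * (A 0 1 : ZMod (p ^ 2)) = 0 := by
    have hy : y = y * v * u := by linear_combination -y * huu
    have h3 : (u : ZMod (p ^ 2)) ^ 2 *
        ((A 0 0 : ZMod (p ^ 2)) - (A 1 1 : ZMod (p ^ 2)) + 2 * (y * v) * (A 0 1 : ZMod (p ^ 2))) = 0 := by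
      linear_combination h2 - h1 * (A 1 1 : ZMod (p ^ 2)) +
        2 * u * y * (A 0 1 : ZMod (p ^ 2)) * huu
    exact ((u.isUnit.pow 2).mul_right_eq_zero).1 h3
  have hmod := prime_mod_four_eq_one_of_sq_eq_neg_one hp hr
  obtain ⟨j, hj⟩ : ∃ j, p = 4 * j + 1 := ⟨p / 4, by omega⟩
  -- `4 j + 1 = p ≤ l ≤ L` gives the crude bound `j < L`.
  refine ⟨j, by omega, hj ▸ hp, ?_⟩
  rw [← hj]
  exact ⟨_, hr, hlin⟩

/-! ### Equidistribution of residues -/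

/-- Index set of the entries on and above the diagonal. -/
abbrev UpperIndex (n : ℕ) : Type := {p : Fin n × Fin n // p.1 ≤ p.2}

/-- Residues modulo `M` of the entries on and above the diagonal. -/
def upperResidues (M : ℕ) {n : ℕ} (A : Matrix (Fin n) (Fin n) ℤ) : UpperIndex n → ZMod M :=
  fun p => (A p.1.1 p.1.2 : ZMod M)

/-- A residue class meets `k` consecutive integers in `k / M` points up to an error of at most 1. -/
theorem tendsto_uniformOn_residue {M : ℕ} (hM : 0 < M) (s : ZMod M) :
    Tendsto (fun k : ℕ => (uniformOn (Set.Icc (1 : ℤ) (k : ℤ))).real {x : ℤ | (x : ZMod M) = s})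
      atTop (𝓝 (1 / (M : ℝ))) := by
  obtain ⟨v, rfl⟩ := ZMod.intCast_surjective s
  have hMr : (0 : ℝ) < M := by exact_mod_cast hM
  have hval : ∀ k : ℕ, (uniformOn (Set.Icc (1 : ℤ) (k : ℤ))).real
      {x : ℤ | (x : ZMod M) = (v : ZMod M)} =
      (((Finset.Ioc (0 : ℤ) k).filter (fun x => x ≡ v [ZMOD (M : ℤ)])).card : ℝ) / k := by
    intro k
    have hI : Set.Icc (1 : ℤ) (k : ℤ) = ((Finset.Ioc (0 : ℤ) k : Finset ℤ) : Set ℤ) := by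
      ext x; simp; omega
    have hset : {x : ℤ | (x : ZMod M) = (v : ZMod M)} = {x : ℤ | x ≡ v [ZMOD (M : ℤ)]} := by
      ext x; exact ZMod.intCast_eq_intCast_iff x v M
    rw [hset, measureReal_def, ← uniformOn_inter_self (hI ▸ Finset.finite_toSet _), hI]
    rw [show ((Finset.Ioc (0 : ℤ) k : Finset ℤ) : Set ℤ) ∩ {x : ℤ | x ≡ v [ZMOD (M : ℤ)]} =
      (((Finset.Ioc (0 : ℤ) k).filter (fun x => x ≡ v [ZMOD (M : ℤ)]) : Finset ℤ) : Set ℤ) by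
        ext x; simp]
    rw [uniformOn_apply_finset, Finset.inter_eq_right.2 (Finset.filter_subset _ _)]
    simp
  have hbound : ∀ k : ℕ, 0 < k → |(uniformOn (Set.Icc (1 : ℤ) (k : ℤ))).real
      {x : ℤ | (x : ZMod M) = (v : ZMod M)} - 1 / M| ≤ 1 / (k : ℝ) := by
    intro k hk
    have hkr : (0 : ℝ) < k := by exact_mod_cast hk
    have hcard := Int.Ioc_filter_modEq_card (0 : ℤ) k (r := (M : ℤ)) (by exact_mod_cast hM) v
    rw [hval]
    set c := ((Finset.Ioc (0 : ℤ) k).filter (fun x => x ≡ v [ZMOD (M : ℤ)])).card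
    have hMq : (0 : ℚ) < M := by exact_mod_cast hM
    have hkM : (0 : ℚ) ≤ k / M := by positivity
    have huw : (((k : ℤ) : ℚ) - v) / ((M : ℤ) : ℚ) =
        (((0 : ℤ) : ℚ) - v) / ((M : ℤ) : ℚ) + k / M := by
      push_cast
      ring
    have h1 := Int.floor_le ((((k : ℤ) : ℚ) - v) / ((M : ℤ) : ℚ))
    have h2 := Int.lt_floor_add_one ((((k : ℤ) : ℚ) - v) / ((M : ℤ) : ℚ))
    have h3 := Int.floor_le ((((0 : ℤ) : ℚ) - v) / ((M : ℤ) : ℚ))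
    have h4 := Int.lt_floor_add_one ((((0 : ℤ) : ℚ) - v) / ((M : ℤ) : ℚ))
    have hmono : ⌊(((0 : ℤ) : ℚ) - v) / ((M : ℤ) : ℚ)⌋ ≤ ⌊(((k : ℤ) : ℚ) - v) / ((M : ℤ) : ℚ)⌋ :=
      Int.floor_mono (by rw [huw]; linarith)
    -- The count is now a difference of two floors whose arguments differ by `k / M`.
    rw [max_eq_left (sub_nonneg.2 hmono)] at hcard
    have hcq := congrArg (Int.cast : ℤ → ℚ) hcard
    rw [Int.cast_sub, Int.cast_natCast] at hcq
    rw [huw] at h1 h2 hcq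
    have hq : |(c : ℚ) - k / M| ≤ 1 := by
      rw [abs_le]
      constructor <;> linarith
    have hq' : |(c : ℝ) - k / M| ≤ 1 := by
      have h := (Rat.cast_le (K := ℝ)).2 hq
      push_cast at h
      exact h
    have : (c : ℝ) / k - 1 / M = (c - k / M) / k := by field_simp
    rw [this, abs_div, abs_of_pos hkr]
    gcongr
  rw [tendsto_iff_norm_sub_tendsto_zero]
  refine squeeze_zero' (Eventually.of_forall fun _ => norm_nonneg _) ?_
    (tendsto_const_div_atTop_nhds_zero_nat (1 : ℝ))
  filter_upwards [eventually_gt_atTop 0] with k hk using hbound k hk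

theorem IsUniformSymmetric.measurableSet_upperResidues_eq {Ω : Type*} [MeasurableSpace Ω] {μ : Measure Ω} {n k : ℕ}
    {X : Ω → Matrix (Fin n) (Fin n) ℤ} (hX : IsUniformSymmetric μ X k) (M : ℕ)
    (s : UpperIndex n → ZMod M) : MeasurableSet {ω | upperResidues M (X ω) = s} := by
  have : {ω | upperResidues M (X ω) = s} =
      ⋂ p : UpperIndex n, (fun ω => X ω p.1.1 p.1.2) ⁻¹' {x : ℤ | (x : ZMod M) = s p} := by
    ext ω; simp [upperResidues, funext_iff]
  rw [this]
  exact MeasurableSet.iInter fun p => hX.measurable_entry _ _ (MeasurableSet.of_discrete)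

theorem IsUniformSymmetric.measureReal_upperResidues_eq {Ω : Type*} [MeasurableSpace Ω]
    {μ : Measure Ω} {n k : ℕ} {X : Ω → Matrix (Fin n) (Fin n) ℤ}
    (hX : IsUniformSymmetric μ X k) (M : ℕ) (s : UpperIndex n → ZMod M) :
    μ.real {ω | upperResidues M (X ω) = s} =
      ∏ p, (uniformOn (Set.Icc (1 : ℤ) (k : ℤ))).real {x : ℤ | (x : ZMod M) = s p} := by
  have h := hX.indep.measure_inter_preimage_eq_mul Finset.univ
    (sets := fun p => {x : ℤ | (x : ZMod M) = s p}) (fun _ _ => MeasurableSet.of_discrete)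
  have : {ω | upperResidues M (X ω) = s} = ⋂ p ∈ (Finset.univ : Finset (UpperIndex n)),
      (fun ω => X ω p.1.1 p.1.2) ⁻¹' {x : ℤ | (x : ZMod M) = s p} := by
    ext ω; simp [upperResidues, funext_iff]
  rw [this, measureReal_def, h, ENNReal.toReal_prod]
  refine Finset.prod_congr rfl fun p _ => ?_
  rw [measureReal_def, ← hX.uniform _ _ p.2,
    Measure.map_apply (hX.measurable_entry _ _) MeasurableSet.of_discrete]

/-- By independence each residue vector has limiting mass `M⁻¹` per coordinate; an event on residues
is a finite disjoint union of these. -/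
theorem tendsto_measure_upperResidues_mem {Ω : ℕ → Type*} [∀ k, MeasurableSpace (Ω k)]
    (μ : (k : ℕ) → Measure (Ω k)) [∀ k, IsProbabilityMeasure (μ k)] {n : ℕ}
    (X : (k : ℕ) → Ω k → Matrix (Fin n) (Fin n) ℤ)
    (hX : ∀ k : ℕ, 1 ≤ k → IsUniformSymmetric (μ k) (X k) k) {M : ℕ} [NeZero M]
    (S : Set (UpperIndex n → ZMod M)) :
    Tendsto (fun k => (μ k).real {ω | upperResidues M (X k ω) ∈ S}) atTop
      (𝓝 (S.ncard * (1 / (M : ℝ)) ^ Fintype.card (UpperIndex n))) := by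
  classical
  have hlim : Tendsto (fun k : ℕ => ∑ s ∈ S.toFinset,
      ∏ p, (uniformOn (Set.Icc (1 : ℤ) (k : ℤ))).real {x : ℤ | (x : ZMod M) = s p}) atTop
      (𝓝 (∑ s ∈ S.toFinset, ∏ p : UpperIndex n, 1 / (M : ℝ))) :=
    tendsto_finsetSum _ fun s _ => tendsto_finsetProd _ fun p _ =>
      tendsto_uniformOn_residue (NeZero.pos M) _
  rw [Finset.sum_const, Finset.prod_const, nsmul_eq_mul, ← Set.ncard_eq_toFinset_card',
    Finset.card_univ] at hlim
  refine hlim.congr' ?_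
  filter_upwards [eventually_ge_atTop 1] with k hk
  have hU : {ω | upperResidues M (X k ω) ∈ S} =
      ⋃ s ∈ S.toFinset, {ω | upperResidues M (X k ω) = s} := by
    ext ω; simp
  rw [hU, measureReal_biUnion_finset _ fun s _ => (hX k hk).measurableSet_upperResidues_eq M s]
  · exact Finset.sum_congr rfl fun s _ => ((hX k hk).measureReal_upperResidues_eq M s).symm
  · intro s _ t _ hst
    exact Set.disjoint_left.2 fun ω h1 h2 => hst (h1.symm.trans h2)

/-! ### Dependence on residues only -/

theorem HasIntegerEntries.mul {n : ℕ} {A B : Matrix (Fin n) (Fin n) ℚ}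
    (hA : HasIntegerEntries A) (hB : HasIntegerEntries B) : HasIntegerEntries (A * B) := by
  obtain ⟨A, rfl⟩ := hA
  obtain ⟨B, rfl⟩ := hB
  exact ⟨A * B, (Matrix.map_mul (f := Int.castRingHom ℚ)).symm⟩

theorem HasIntegerEntries.add {n : ℕ} {A B : Matrix (Fin n) (Fin n) ℚ}
    (hA : HasIntegerEntries A) (hB : HasIntegerEntries B) : HasIntegerEntries (A + B) := by
  obtain ⟨A, rfl⟩ := hA
  obtain ⟨B, rfl⟩ := hB
  exact ⟨A + B, by ext; simp⟩

theorem HasIntegerEntries.transpose {n : ℕ} {A : Matrix (Fin n) (Fin n) ℚ}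
    (hA : HasIntegerEntries A) : HasIntegerEntries A.transpose := by
  obtain ⟨A, rfl⟩ := hA
  exact ⟨A.transpose, rfl⟩

theorem hasIntegerEntries_matrixLevel_smul {n : ℕ} {Q : Matrix (Fin n) (Fin n) ℚ}
    (hQ : 0 < matrixLevel Q) : HasIntegerEntries ((matrixLevel Q : ℚ) • Q) :=
  (Nat.sInf_mem (Nat.nonempty_of_pos_sInf hQ)).2

/-- Being conjugate to an integer matrix by a rational orthogonal matrix of level in `[2, L]`
only depends on the entries modulo `L!²`. -/
theorem RationallyCospectral.of_congr {n L : ℕ} {A A' : Matrix (Fin n) (Fin n) ℤ}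
    (hAA' : ∀ i j, (A i j : ZMod (L.factorial ^ 2)) = A' i j) (h : RationallyCospectral L A) :
    RationallyCospectral L A' := by
  obtain ⟨Q, hQ, hN⟩ := h
  refine ⟨Q, hQ, ?_⟩
  simp only [Set.mem_iUnion] at hQ
  obtain ⟨l, ⟨hl2, hlL⟩, -, rfl⟩ := hQ
  have hlQ := hasIntegerEntries_matrixLevel_smul (Q := Q) (by omega)
  have hdvd : ∀ i j, ((matrixLevel Q : ℤ) ^ 2) ∣ A' i j - A i j := fun i j => by
    have h1 := (ZMod.intCast_eq_intCast_iff_dvd_sub _ _ _).1 (hAA' i j)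
    have h2 : matrixLevel Q ∣ L.factorial := Nat.dvd_factorial (by omega) hlL
    exact (by exact_mod_cast pow_dvd_pow_of_dvd h2 2 :
      ((matrixLevel Q : ℤ) ^ 2) ∣ ((L.factorial ^ 2 : ℕ) : ℤ)).trans h1
  choose C hC using hdvd
  have hA' : A'.map (Int.cast : ℤ → ℚ) = A.map (Int.cast : ℤ → ℚ) +
      (matrixLevel Q : ℚ) ^ 2 • (Matrix.of C).map (Int.cast : ℤ → ℚ) := by
    ext i j
    have := congrArg (Int.cast : ℤ → ℚ) (hC i j)
    push_cast at this
    simp only [Matrix.map_apply, Matrix.add_apply, Matrix.smul_apply, Matrix.of_apply, smul_eq_mul]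
    linear_combination this
  -- The factor `l²` is shared between the two copies of `Q`, so the correction term is a product of
  -- integer matrices.
  have hexp : Q.transpose * A'.map (Int.cast : ℤ → ℚ) * Q =
      Q.transpose * A.map (Int.cast : ℤ → ℚ) * Q +
      ((matrixLevel Q : ℚ) • Q).transpose * (Matrix.of C).map (Int.cast : ℤ → ℚ) *
        ((matrixLevel Q : ℚ) • Q) := by
    rw [hA']
    simp only [Matrix.mul_add, Matrix.add_mul, Matrix.transpose_smul, Matrix.smul_mul,
      Matrix.mul_smul, smul_smul, sq]
  rw [hexp]
  exact hN.add ((hlQ.transpose.mul ⟨_, rfl⟩).mul hlQ)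

theorem RationallyCospectral.mono {n L L' : ℕ} (hLL' : L ≤ L') {A : Matrix (Fin n) (Fin n) ℤ}
    (h : RationallyCospectral L A) : RationallyCospectral L' A := by
  obtain ⟨Q, hQ, hN⟩ := h
  exact ⟨Q, Set.biUnion_subset_biUnion_left (Set.Icc_subset_Icc_right hLL') hQ, hN⟩

theorem eq_entries_of_upperResidues_eq {M n : ℕ} {A A' : Matrix (Fin n) (Fin n) ℤ}
    (hA : A.IsSymm) (hA' : A'.IsSymm) (h : upperResidues M A = upperResidues M A')
    (i j : Fin n) : (A i j : ZMod M) = A' i j := by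
  rcases le_total i j with hij | hij
  · exact congrFun h ⟨(i, j), hij⟩
  · rw [← hA.apply, ← hA'.apply]
    exact congrFun h ⟨(j, i), hij⟩

/-! ### Counting and passage to the limit -/

/-- The residues `(a, b, c)` with `a - c + 2 r b = 0`. -/
def linearResidues (M : ℕ) (r : ZMod M) : Set (UpperIndex 2 → ZMod M) :=
  {f | f ⟨(0, 0), le_rfl⟩ - f ⟨(1, 1), le_rfl⟩ + 2 * r * f ⟨(0, 1), Fin.zero_le _⟩ = 0}

/-- The relation determines `a` from `b` and `c`, so the density among all `M³` triples is at most
`1 / M`. -/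
theorem ncard_linearResidues_le (M : ℕ) [NeZero M] (r : ZMod M) :
    (linearResidues M r).ncard ≤ M ^ 2 := by
  have := Set.ncard_le_ncard_of_injOn (s := linearResidues M r) (t := Set.univ)
    (fun f => ((f ⟨(0, 1), Fin.zero_le _⟩, f ⟨(1, 1), le_rfl⟩) : ZMod M × ZMod M))
    (fun _ _ => Set.mem_univ _) (by
      intro f hf g hg hfg
      simp only [Prod.mk.injEq] at hfg
      obtain ⟨h1, h2⟩ := hfg
      simp only [linearResidues, Set.mem_ofPred_eq] at hf hg
      rw [← h1, ← h2] at hg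
      funext ⟨⟨i, j⟩, hij⟩
      fin_cases i <;> fin_cases j
      · change f ⟨(0, 0), le_rfl⟩ = g ⟨(0, 0), le_rfl⟩
        linear_combination hf - hg
      · exact h1
      · exact absurd hij (by decide)
      · exact h2) (Set.finite_univ)
  simpa [Set.ncard_univ, Nat.card_prod, sq] using this

theorem exists_tendsto_measure_rationallyCospectral {Ω : ℕ → Type*} [∀ k, MeasurableSpace (Ω k)]
    (μ : (k : ℕ) → Measure (Ω k)) [∀ k, IsProbabilityMeasure (μ k)] {n : ℕ}
    (X : (k : ℕ) → Ω k → Matrix (Fin n) (Fin n) ℤ)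
    (hX : ∀ k : ℕ, 1 ≤ k → IsUniformSymmetric (μ k) (X k) k) (L : ℕ) :
    ∃ p : ℝ, Tendsto (fun k : ℕ => (μ k).real {ω | RationallyCospectral L (X k ω)})
        atTop (𝓝 p) := by
  have : NeZero (L.factorial ^ 2) := ⟨pow_ne_zero _ L.factorial_ne_zero⟩
  -- By periodicity and symmetry, having residues in this image is equivalent to the event itself.
  refine ⟨_, (tendsto_measure_upperResidues_mem μ X hX (M := L.factorial ^ 2)
    (upperResidues _ '' {A | A.IsSymm ∧ RationallyCospectral L A})).congr' ?_⟩
  filter_upwards [eventually_ge_atTop 1] with k hk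
  congr 1
  ext ω
  constructor
  · rintro ⟨A, ⟨hA, hRC⟩, hAX⟩
    exact hRC.of_congr (eq_entries_of_upperResidues_eq hA ((hX k hk).isSymm ω) hAX)
  · exact fun h => ⟨_, ⟨(hX k hk).isSymm ω, h⟩, rfl⟩

/-- Union bound for each `k` over primes and roots, followed by the limit in `k`; with `M = p²` each
root contributes at most `1 / p²`. -/
theorem limit_measure_rationallyCospectral_le {Ω : ℕ → Type*} [∀ k, MeasurableSpace (Ω k)]
    (μ : (k : ℕ) → Measure (Ω k)) [∀ k, IsProbabilityMeasure (μ k)]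
    (X : (k : ℕ) → Ω k → Matrix (Fin 2) (Fin 2) ℤ)
    (hX : ∀ k : ℕ, 1 ≤ k → IsUniformSymmetric (μ k) (X k) k) {L : ℕ} {p : ℝ}
    (hp : Tendsto (fun k : ℕ => (μ k).real {ω | RationallyCospectral L (X k ω)}) atTop (𝓝 p)) :
    p ≤ ∑ j ∈ Finset.range L,
      (if (4 * j + 1).Prime then 2 / ((4 * j + 1 : ℕ) : ℝ) ^ 2 else 0) := by
  classical
  have hcard : Fintype.card (UpperIndex 2) = 3 := by decide
  set J := (Finset.range L).filter fun j => (4 * j + 1).Prime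
  set R : (j : ℕ) → Finset (ZMod ((4 * j + 1) ^ 2)) := fun j =>
    {r : ZMod ((4 * j + 1) ^ 2) | r ^ 2 = -1}.toFinset
  have hlim : Tendsto (fun k : ℕ => ∑ j ∈ J, ∑ r ∈ R j,
      (μ k).real {ω | upperResidues ((4 * j + 1) ^ 2) (X k ω) ∈ linearResidues _ r}) atTop
      (𝓝 (∑ j ∈ J, ∑ r ∈ R j, ((linearResidues ((4 * j + 1) ^ 2) r).ncard : ℝ) *
        (1 / (((4 * j + 1) ^ 2 : ℕ) : ℝ)) ^ Fintype.card (UpperIndex 2))) :=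
    tendsto_finsetSum _ fun j _ => tendsto_finsetSum _ fun r _ =>
      tendsto_measure_upperResidues_mem μ X hX _
  have hle : p ≤ ∑ j ∈ J, ∑ r ∈ R j, ((linearResidues ((4 * j + 1) ^ 2) r).ncard : ℝ) *
        (1 / (((4 * j + 1) ^ 2 : ℕ) : ℝ)) ^ Fintype.card (UpperIndex 2) := by
    refine le_of_tendsto_of_tendsto hp hlim ?_
    filter_upwards [eventually_ge_atTop 1] with k hk
    have hsub : {ω | RationallyCospectral L (X k ω)} ⊆ ⋃ j ∈ J, ⋃ r ∈ R j,
        {ω | upperResidues ((4 * j + 1) ^ 2) (X k ω) ∈ linearResidues _ r} := by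
      intro ω hω
      obtain ⟨j, hj, hpr, r, hr, hlin⟩ := hω.exists_root ((hX k hk).isSymm ω)
      simp only [Set.mem_iUnion]
      exact ⟨j, by simp [J, hj, hpr], r, by simp [R, hr], hlin⟩
    refine (measureReal_mono hsub (measure_ne_top _ _)).trans ((measureReal_biUnion_finset_le _ _).trans ?_)
    exact Finset.sum_le_sum fun j _ => measureReal_biUnion_finset_le _ _
  refine hle.trans ?_
  rw [← Finset.sum_filter]
  refine Finset.sum_le_sum fun j hj => ?_
  have hpr : (4 * j + 1).Prime := (Finset.mem_filter.1 hj).2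
  have hq : (0 : ℝ) < (((4 * j + 1) ^ 2 : ℕ) : ℝ) := by positivity
  have hRc : ((R j).card : ℝ) ≤ 2 := by
    have := ZMod.ncard_sq_eq_neg_one_le hpr (by omega)
    rw [Set.ncard_eq_toFinset_card'] at this
    exact_mod_cast this
  have hterm : ∀ r ∈ R j, ((linearResidues ((4 * j + 1) ^ 2) r).ncard : ℝ) *
      (1 / (((4 * j + 1) ^ 2 : ℕ) : ℝ)) ^ Fintype.card (UpperIndex 2) ≤
      1 / (((4 * j + 1) ^ 2 : ℕ) : ℝ) := by
    intro r _
    have h := ncard_linearResidues_le ((4 * j + 1) ^ 2) r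
    have h' : ((linearResidues ((4 * j + 1) ^ 2) r).ncard : ℝ) ≤
        (((4 * j + 1) ^ 2 : ℕ) : ℝ) ^ 2 := by exact_mod_cast h
    rw [hcard]
    refine (mul_le_mul_of_nonneg_right h' (by positivity)).trans (le_of_eq ?_)
    field_simp
  refine (Finset.sum_le_card_nsmul _ _ _ hterm).trans ?_
  rw [nsmul_eq_mul, mul_one_div, Nat.cast_pow]
  rw [Nat.cast_pow] at hq
  gcongr

theorem mainTheorem9 {Ω : ℕ → Type*} [∀ k, MeasurableSpace (Ω k)]
    (μ : (k : ℕ) → Measure (Ω k)) [∀ k, IsProbabilityMeasure (μ k)]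
    (X : (k : ℕ) → Ω k → Matrix (Fin 2) (Fin 2) ℤ)
    (hX : ∀ k : ℕ, 1 ≤ k → IsUniformSymmetric (μ k) (X k) k) :
    (∃ (p : ℕ → ℝ) (P : ℝ),
      (∀ L : ℕ, Tendsto (fun k : ℕ => (μ k).real {ω | RationallyCospectral L (X k ω)})
        atTop (𝓝 (p L))) ∧
      Tendsto p atTop (𝓝 P) ∧
      P ≤ 12 * catalanConstant / Real.pi ^ 2 - 1) ∧
    |12 * catalanConstant / Real.pi ^ 2 - 1 - 0.1137| < 0.00005 := by

  have hnum := abs_catalan_approx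
  refine ⟨?_, hnum⟩
  choose p hp using exists_tendsto_measure_rationallyCospectral μ X hX
  -- The numerical estimate gives more than `0.11365` on the right, above the prime sum bound
  -- `0.1136`.
  have hbound : ∀ L, p L ≤ 12 * catalanConstant / Real.pi ^ 2 - 1 := fun L =>
    ((limit_measure_rationallyCospectral_le μ X hX (hp L)).trans (sum_prime_le L)).trans
      (by linarith [(abs_lt.1 hnum).1])
  have hmono : Monotone p := fun L L' h => le_of_tendsto_of_tendsto' (hp L) (hp L') fun k =>
    measureReal_mono fun ω hω => RationallyCospectral.mono h hω
  have hbdd : BddAbove (Set.range p) := ⟨_, Set.forall_mem_range.2 hbound⟩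
  exact ⟨p, _, hp, tendsto_atTop_ciSup hmono hbdd, ciSup_le hbound⟩
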